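/- For a positive integer $n$ let $\sigma_k(n)=\sum_{d\mid n} d^k$, and let Ramanujan's function $\tau$ be defined by $$\Delta(z)=q\prod_{k\ge 1}(1-q^k)^{24}=\sum_{n\ge 1}\tau(n)q^n,\qquad q=e^{2\pi i z},\ \operatorname{Im} z>0.$$ Then for every integer $n\ge 1$ the following five identities hold: $$\text{(i)}\quad \tau(n) = -\frac{11}{24}\, n\sigma_9(n) + \frac{35}{24}\, n\sigma_5(n) + 350\sum_{m=1}^{n-1}(n-m)\sigma_3(m)\sigma_5(n-m),$$ $$\text{(ii)}\quad \tau(n) = \frac{11}{36}\, n\sigma_9(n) + \frac{25}{36}\, n\sigma_3(n) - 350\sum_{m=1}^{n-1}m\,\sigma_3(m)\sigma_5(n-m),$$ $$\text{(iii)}\quad \tau(n) = \frac{1}{6}\, n\sigma_9(n) + \frac{5}{6}\, n\sigma_3(n) - \frac{420}{n}\sum_{m=1}^{n-1}m^2\sigma_3(m)\sigma_5(n-m),$$ $$\text{(iv)}\quad \tau(n) = n\sigma_9(n) - \frac{2100}{n}\sum_{m=1}^{n-1}m(n-m)\sigma_3(m)\sigma_5(n-m),$$ $$\text{(v)}\quad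 \tau(n) = -\frac{1}{4}\, n\sigma_9(n) + \frac{5}{4}\, n\sigma_5(n) + \frac{300}{n}\sum_{m=1}^{n-1}(n-m)^2\sigma_3(m)\sigma_5(n-m).$$ -/

import Mathlib

open scoped ArithmeticFunction.sigma

/-- The Ramanujan tau function: `ramanujanTau n` is the `n`-th Fourier coefficient of the
discriminant function `Δ(z) = q ∏_{k ≥ 1} (1 - q ^ k) ^ 24`, where `q = e ^ (2 π i z)`. -/
noncomputable def ramanujanTau (n : ℕ) : ℂ :=
  (UpperHalfPlane.qExpansion 1 ModularForm.discriminant).coeff n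

/-- The defining expansion `q ∏_{k ≥ 1} (1 - q ^ k) ^ 24 = ∑ τ(n) q ^ n` on the upper half-plane. -/
theorem ramanujanTau_hasSum (z : UpperHalfPlane) :
    HasSum (fun n : ℕ ↦
        ramanujanTau n * Complex.exp (2 * Real.pi * Complex.I * (z : ℂ)) ^ n)
      (Complex.exp (2 * Real.pi * Complex.I * (z : ℂ)) *
        ∏' k : ℕ, (1 - Complex.exp (2 * Real.pi * Complex.I * (z : ℂ)) ^ (k + 1)) ^ 24) := by
  have h := ModularForm.hasSum_qExpansion (h := 1) CuspForm.discriminant one_pos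
    (by simp) z
  have h2 := ModularForm.discriminant_eq_q_prod z
  simp only [CuspForm.coe_discriminant, h2] at h
  simpa [Function.Periodic.qParam, ModularForm.eta_q, ramanujanTau] using h

/-- The expansion has no constant term. -/
theorem ramanujanTau_zero : ramanujanTau 0 = 0 := by
  have h := CuspFormClass.qExpansion_coeff_zero (h := 1) CuspForm.discriminant one_pos (by simp)
  simpa [ramanujanTau] using h

/-! Write `S i j` for `sigmaConv n i j`. Three identities between Eisenstein series each give, on
comparing `q`-coefficients, one linear relation among these sums: `E₄E₆ = E₁₀` for `S 0 0`, the
first Rankin-Cohen bracket of `E₄, E₆` (a multiple of `Δ`, whence `τ`) for `S 0 1, S 1 0`, and the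
vanishing second bracket for `S 0 2, S 1 1, S 2 0`. Splitting `n = m + (n - m)` gives three more, so
all six sums are determined by `τ, σ₃, σ₅, σ₉`. The brackets follow algebraically from Ramanujan's
formulas for the derivatives of `E₂, E₄, E₆`. These, like `E₄E₆ = E₁₀`, hold because a level one
form of weight below 12 without constant term is zero. -/

open UpperHalfPlane hiding I
open ModularForm EisensteinSeries Derivative Complex
open scoped Manifold MatrixGroups

/-! ### Calculus of `q`-expansions -/

/-- `HasQExpansion f p`: the function `f` is holomorphic on the upper half-plane and is the sum of
the power series `p` in `q = e ^ (2 π i z)`. -/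
structure HasQExpansion (f : ℍ → ℂ) (p : PowerSeries ℂ) : Prop where
  mdiff : MDiff f
  hasSum : ∀ z : ℍ, HasSum (fun m ↦ p.coeff m • Function.Periodic.qParam 1 (z : ℂ) ^ m) (f z)

/-- The operator `q d/dq` on power series. -/
noncomputable def thetaSeries (p : PowerSeries ℂ) : PowerSeries ℂ :=
  PowerSeries.X * PowerSeries.derivative ℂ p

lemma coeff_thetaSeries (p : PowerSeries ℂ) (n : ℕ) :
    (thetaSeries p).coeff n = n * p.coeff n := by
  cases n with
  | zero => simp [thetaSeries]
  | succ n =>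
    rw [thetaSeries, PowerSeries.coeff_succ_X_mul, PowerSeries.coeff_derivative]
    push_cast
    ring

lemma thetaSeries_mul (p r : PowerSeries ℂ) :
    thetaSeries (p * r) = thetaSeries p * r + p * thetaSeries r := by
  simp only [thetaSeries, Derivation.leibniz, smul_eq_mul]
  ring

lemma thetaSeries_sub (p r : PowerSeries ℂ) :
    thetaSeries (p - r) = thetaSeries p - thetaSeries r := by
  simp [thetaSeries, mul_sub]

namespace HasQExpansion

variable {f g : ℍ → ℂ} {p r : PowerSeries ℂ}

lemma periodic (hf : HasQExpansion f p) :
    Function.Periodic (f ∘ ofComplex) ((1 : ℝ) : ℂ) := by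
  intro w
  by_cases hw : 0 < w.im
  · have hw' : 0 < (w + ((1 : ℝ) : ℂ)).im := by simpa using hw
    simp only [Function.comp_apply, ofComplex_apply_of_im_pos hw, ofComplex_apply_of_im_pos hw']
    have h1 := hf.hasSum ⟨w, hw⟩
    have h2 := hf.hasSum ⟨_, hw'⟩
    have h3 : Function.Periodic.qParam 1 (w + ((1 : ℝ) : ℂ)) = Function.Periodic.qParam 1 w := by
      simp [Function.Periodic.qParam, mul_add, exp_add]
    simp only [h3] at h2
    exact h2.unique h1
  -- Off the upper half-plane `ofComplex` is a constant junk value.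
  · have hw' : (w + ((1 : ℝ) : ℂ)).im ≤ 0 := by simpa using hw
    simp only [Function.comp_apply, ofComplex_apply_of_im_nonpos hw',
      ofComplex_apply_of_im_nonpos (not_lt.mp hw)]

lemma isBoundedAtImInfty (hf : HasQExpansion f p) : IsBoundedAtImInfty f :=
  isBoundedAtImInfty_of_hasSum_qExpansion one_pos hf.hasSum

lemma analyticAt_cuspFunction (hf : HasQExpansion f p) : AnalyticAt ℂ (cuspFunction 1 f) 0 :=
  analyticAt_cuspFunction_zero one_pos hf.periodic hf.mdiff hf.isBoundedAtImInfty

lemma qExpansion_eq (hf : HasQExpansion f p) : qExpansion 1 f = p := by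
  ext m
  have h1 := (hasFPowerSeriesOnBall_cuspFunction one_pos hf.analyticAt_cuspFunction
    hf.hasSum).hasFPowerSeriesAt
  have h2 : HasFPowerSeriesAt (cuspFunction 1 f)
      (.ofScalars ℂ fun m ↦ (qExpansion 1 f).coeff m) 0 := by
    simpa [qExpansion_coeff, div_eq_mul_inv, mul_comm] using hf.analyticAt_cuspFunction.hasFPowerSeriesAt
  simpa using congr_arg (FormalMultilinearSeries.coeff · m) (h2.eq_formalMultilinearSeries h1)

lemma mul (hf : HasQExpansion f p) (hg : HasQExpansion g r) : HasQExpansion (f * g) (p * r) where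
  mdiff := hf.mdiff.mul hg.mdiff
  hasSum z := by
    have hper : Function.Periodic ((f * g) ∘ ofComplex) ((1 : ℝ) : ℂ) :=
      hf.periodic.mul hg.periodic
    have hb : IsBoundedAtImInfty (f * g) :=
      Filter.BoundedAtFilter.mul hf.isBoundedAtImInfty hg.isBoundedAtImInfty
    have h := hasSum_qExpansion one_pos hper (hf.mdiff.mul hg.mdiff) hb z
    rwa [qExpansion_mul hf.analyticAt_cuspFunction hg.analyticAt_cuspFunction, hf.qExpansion_eq,
      hg.qExpansion_eq] at h

lemma add (hf : HasQExpansion f p) (hg : HasQExpansion g r) : HasQExpansion (f + g) (p + r) where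
  mdiff := hf.mdiff.add hg.mdiff
  hasSum z := by simpa [add_mul] using (hf.hasSum z).add (hg.hasSum z)

lemma sub (hf : HasQExpansion f p) (hg : HasQExpansion g r) : HasQExpansion (f - g) (p - r) where
  mdiff := hf.mdiff.sub hg.mdiff
  hasSum z := by simpa [sub_mul] using (hf.hasSum z).sub (hg.hasSum z)

lemma smul (c : ℂ) (hf : HasQExpansion f p) : HasQExpansion (c • f) (c • p) where
  mdiff := hf.mdiff.const_smul c
  hasSum z := by simpa [mul_assoc] using (hf.hasSum z).mul_left c

/-- Chain rule: `f = F ∘ q` with `q' = 2πi q`, so the derivative divided by `2πi` is `q F'(q)`. -/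
lemma normalizedDeriv (hf : HasQExpansion f p) :
    HasQExpansion (normalizedDerivOfComplex f) (thetaSeries p) where
  mdiff := normalizedDerivOfComplex_mdifferentiable hf.mdiff
  hasSum z := by
    set F := cuspFunction 1 f
    have hF : DifferentiableOn ℂ F (Metric.ball 0 1) :=
      differentiableOn_cuspFunction_ball one_pos hf.periodic hf.mdiff hf.isBoundedAtImInfty
    set q := Function.Periodic.qParam 1 (z : ℂ) with hq
    have hq1 : q ∈ Metric.ball (0 : ℂ) 1 := by
      simpa using Function.Periodic.norm_qParam_lt_one one_pos z.im_pos
    have hD : normalizedDerivOfComplex f z = q * deriv F q := by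
      have hFq : HasDerivAt F (deriv F q) q :=
        (hF.differentiableAt (Metric.isOpen_ball.mem_nhds hq1)).hasDerivAt
      have hqd : HasDerivAt (Function.Periodic.qParam 1) (2 * Real.pi * I * q) (z : ℂ) := by
        have h : HasDerivAt (fun w : ℂ ↦ 2 * Real.pi * I * w / ((1 : ℝ) : ℂ))
            (2 * Real.pi * I) (z : ℂ) := by
          simpa using ((hasDerivAt_id (z : ℂ)).const_mul (2 * Real.pi * I))
        rw [mul_comm]
        exact h.cexp
      have hev : f ∘ ofComplex =ᶠ[nhds (z : ℂ)] F ∘ Function.Periodic.qParam 1 := by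
        filter_upwards [isOpen_upperHalfPlaneSet.mem_nhds z.im_pos] with w hw
        have := eq_cuspFunction (h := 1) ⟨w, hw⟩ one_ne_zero hf.periodic
        simp only [Function.comp_apply, ofComplex_apply_of_im_pos hw]
        exact this.symm
      rw [normalizedDerivOfComplex, hev.deriv_eq, (hFq.comp (z : ℂ) hqd).deriv]
      field_simp [two_pi_I_ne_zero]
    have hdF := hasSum_taylorSeries_on_ball (hF.deriv Metric.isOpen_ball) hq1
    rw [hD, ← hasSum_nat_add_iff' 1]
    have hc : ∀ n, (thetaSeries p).coeff (n + 1) = (n.factorial : ℂ)⁻¹ *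
        iteratedDeriv n (deriv F) 0 := by
      intro n
      rw [coeff_thetaSeries, ← hf.qExpansion_eq, qExpansion_coeff, ← iteratedDeriv_succ',
        Nat.factorial_succ]
      push_cast
      field_simp
      rfl
    have h := hdF.mul_left q
    simp only [sub_zero, smul_eq_mul] at h
    simp only [hc, smul_eq_mul, Finset.range_one, Finset.sum_singleton, coeff_thetaSeries,
      Nat.cast_zero, zero_mul, sub_zero]
    refine h.congr_fun fun n ↦ ?_
    ring

lemma serreDeriv (k : ℂ) (hf : HasQExpansion f p) (hE : HasQExpansion E2 r) :
    HasQExpansion (serreDerivative k f) (thetaSeries p - (k / 12) • (r * p)) := by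
  have h : serreDerivative k f = normalizedDerivOfComplex f - (k / 12) • (E2 * f) := by
    ext z
    simp only [serreDerivative_apply, Pi.sub_apply, Pi.smul_apply, Pi.mul_apply, smul_eq_mul]
    ring
  rw [h]
  exact hf.normalizedDeriv.sub ((hE.mul hf).smul _)

/-- The Sturm bound `⌊k / 12⌋` is 0 here, so positive order at infinity forces vanishing. Invariance
carries boundedness at infinity to every cusp. -/
lemma eq_zero_of_slash_eq {k : ℤ} (hk : k < 12) (hf : HasQExpansion f p)
    (hslash : ∀ γ : SL(2, ℤ), f ∣[k] γ = f) (h0 : p.constantCoeff = 0) : p = 0 := by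
  let F : ModularForm 𝒮ℒ k :=
    { toFun := f
      slash_action_eq' := fun _ ⟨γ, hγ⟩ ↦ hγ ▸ hslash γ
      holo' := hf.mdiff
      bdd_at_cusps' {c} hc := by
        rw [Subgroup.IsArithmetic.isCusp_iff_isCusp_SL2Z] at hc
        rw [OnePoint.isBoundedAt_iff_forall_SL2Z hc]
        intro γ _
        rw [hslash γ]
        exact hf.isBoundedAtImInfty }
  have hF : F = 0 := by
    apply sturm_bound_levelOne
    have hk' : k.toNat / 12 = 0 := by omega
    change _ < (qExpansion 1 f).order
    rw [hk', hf.qExpansion_eq]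
    exact_mod_cast PowerSeries.order_ne_zero_iff_constCoeff_eq_zero.mpr h0 |>.bot_lt
  have hf0 : f = 0 := congrArg DFunLike.coe hF
  rw [← hf.qExpansion_eq, hf0, qExpansion_zero]

end HasQExpansion

/-! ### Ramanujan's differential equations -/

lemma hasQExpansion_modularForm {k : ℤ} (f : ModularForm 𝒮ℒ k) :
    HasQExpansion f (qExpansion 1 f) where
  mdiff := f.holo'
  hasSum z := by
    simpa using ModularForm.hasSum_qExpansion (h := 1) f one_pos one_mem_strictPeriods_SL z

/-- The `q`-expansion of `E2`. -/
noncomputable def e2Series : PowerSeries ℂ :=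
  PowerSeries.mk fun m ↦ if m = 0 then 1 else -24 * σ 1 m

lemma hasQExpansion_E2 : HasQExpansion E2 e2Series where
  mdiff := E2_mdifferentiable
  hasSum z := by
    simpa [e2Series, Function.Periodic.qParam] using hasSum_qExpansion_E2 (z := z)

lemma constantCoeff_e2Series : e2Series.constantCoeff = 1 := by
  rw [← PowerSeries.coeff_zero_eq_constantCoeff_apply]
  simp [e2Series]

lemma slash_modularForm {k : ℤ} (f : ModularForm 𝒮ℒ k) (γ : SL(2, ℤ)) :
    (f : ℍ → ℂ) ∣[k] γ = f :=
  f.slash_action_eq' _ ⟨γ, rfl⟩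

/-- Clears the scalar denominators in Ramanujan's formulas, making the bracket computations
polynomial identities over the integers. -/
lemma natCast_mul_inv_smul {n : ℕ} (hn : n ≠ 0) (p : PowerSeries ℂ) :
    (n : PowerSeries ℂ) * ((n : ℂ)⁻¹ • p) = p := by
  rw [← nsmul_eq_mul, ← Nat.cast_smul_eq_nsmul ℂ, smul_smul,
    mul_inv_cancel₀ (Nat.cast_ne_zero.mpr hn), one_smul]

lemma thetaSeries_natCast_mul (n : ℕ) (p : PowerSeries ℂ) :
    thetaSeries (n * p) = n * thetaSeries p := by
  rw [thetaSeries_mul]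
  simp [thetaSeries]

lemma constantCoeff_thetaSeries (p : PowerSeries ℂ) : (thetaSeries p).constantCoeff = 0 := by
  simp [thetaSeries]

lemma constantCoeff_E {k : ℕ} (hk : 3 ≤ k) (hk2 : Even k) :
    (qExpansion 1 (E hk)).constantCoeff = 1 := by
  simpa using E_qExpansion_coeff_zero hk hk2

/-- Ramanujan's identity for the derivative of `E₄`. -/
lemma theta_E4 : thetaSeries (qExpansion 1 E₄) =
    (3⁻¹ : ℂ) • (e2Series * qExpansion 1 E₄ - qExpansion 1 E₆) := by
  have hE := hasQExpansion_modularForm E₄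
  -- The Serre derivative has weight 6 and constant term `-4/12`, which `E₆ / 3` cancels.
  have h := (hE.serreDeriv ((4 : ℤ) : ℂ) hasQExpansion_E2).add
    ((hasQExpansion_modularForm E₆).smul 3⁻¹)
  have h0 := h.eq_zero_of_slash_eq (k := 4 + 2) (by norm_num) (fun γ ↦ by
    rw [SlashAction.add_slash, ModularForm.SL_smul_slash,
      serreDerivative_slash_invariant hE.mdiff (slash_modularForm E₄ γ)]
    congr 2
    exact slash_modularForm E₆ γ) (by
    simp only [map_add, map_sub, PowerSeries.constantCoeff_smul, map_mul, constantCoeff_thetaSeries,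
      constantCoeff_E _ (show Even 4 by decide), constantCoeff_E _ (show Even 6 by decide),
      constantCoeff_e2Series]
    norm_num)
  norm_num at h0
  norm_num [smul_sub]
  linear_combination h0

/-- Ramanujan's identity for the derivative of `E₆`. -/
lemma theta_E6 : thetaSeries (qExpansion 1 E₆) =
    (2⁻¹ : ℂ) • (e2Series * qExpansion 1 E₆ - qExpansion 1 E₄ * qExpansion 1 E₄) := by
  have hE := hasQExpansion_modularForm E₆
  have h := (hE.serreDeriv ((6 : ℤ) : ℂ) hasQExpansion_E2).add
    (((hasQExpansion_modularForm E₄).mul (hasQExpansion_modularForm E₄)).smul 2⁻¹)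
  have h0 := h.eq_zero_of_slash_eq (k := 6 + 2) (by norm_num) (fun γ ↦ by
    rw [SlashAction.add_slash, ModularForm.SL_smul_slash,
      serreDerivative_slash_invariant hE.mdiff (slash_modularForm E₆ γ)]
    congr 2
    exact slash_modularForm (E₄.mul E₄) γ) (by
    simp only [map_add, map_sub, PowerSeries.constantCoeff_smul, map_mul, constantCoeff_thetaSeries,
      constantCoeff_E _ (show Even 4 by decide), constantCoeff_E _ (show Even 6 by decide),
      constantCoeff_e2Series]
    norm_num)
  norm_num at h0
  norm_num [smul_sub]
  linear_combination h0

/-- `D2 γ` measures the failure of `E2` to be modular; its derivative enters the transformation law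
of `D E₂`. -/
lemma normalizedDeriv_D2 (γ : SL(2, ℤ)) (z : ℍ) :
    normalizedDerivOfComplex (D2 γ) z = -((γ 1 0 : ℂ) / denom γ z) ^ 2 := by
  have hd := (hasDerivAt_denom_zpow (γ : GL (Fin 2) ℝ) (-1) z).const_mul
    (2 * Real.pi * I * γ 1 0)
  have hev : D2 γ ∘ ofComplex =ᶠ[nhds (z : ℂ)]
      fun w ↦ 2 * Real.pi * I * γ 1 0 * denom γ w ^ (-1 : ℤ) := by
    filter_upwards [isOpen_upperHalfPlaneSet.mem_nhds z.im_pos] with w hw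
    simp [D2, ofComplex_apply_of_im_pos hw, div_eq_mul_inv]
  rw [normalizedDerivOfComplex, hev.deriv_eq, hd.deriv]
  have := denom_ne_zero (γ : GL (Fin 2) ℝ) z
  have h2 := two_pi_I_ne_zero
  rw [show (-1 - 1 : ℤ) = -2 by norm_num, zpow_neg]
  simp
  field_simp
  rw [I_sq]
  ring

lemma mdiff_D2 (γ : SL(2, ℤ)) : MDiff (D2 γ) := by
  have h : D2 γ = (2 * riemannZeta 2) • (E2 - E2 ∣[(2 : ℤ)] γ) := by
    rw [E2_slash_action]
    ext z
    have : riemannZeta 2 ≠ 0 := riemannZeta_ne_zero_of_one_lt_re (by norm_num)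
    simp
    field_simp
  rw [h]
  exact (E2_mdifferentiable.sub (E2_mdifferentiable.slash 2 γ)).const_smul _

/-- The weight 4 invariance of `D E₂ - E₂² / 12`. -/
lemma slash_normalizedDeriv_E2_sub (γ : SL(2, ℤ)) :
    (normalizedDerivOfComplex E2 - (12⁻¹ : ℂ) • (E2 * E2)) ∣[(4 : ℤ)] γ =
      normalizedDerivOfComplex E2 - (12⁻¹ : ℂ) • (E2 * E2) := by
  have h1 := normalizedDerivOfComplex_SL_slash (k := 2) E2_mdifferentiable (γ := γ)
  have h2 := ModularForm.mul_slash_SL2 2 2 γ E2 E2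
  rw [E2_slash_action, normalizedDerivOfComplex_sub _ _ E2_mdifferentiable
    ((mdiff_D2 γ).const_smul _), normalizedDerivOfComplex_smul _ _ (mdiff_D2 γ)] at h1
  rw [E2_slash_action] at h2
  rw [sub_eq_add_neg, SlashAction.add_slash, SlashAction.neg_slash, ModularForm.SL_smul_slash,
    show (4 : ℤ) = 2 + 2 by norm_num, h2]
  ext z
  have h1z := congrFun h1 z
  have hpi : (Real.pi : ℂ) ≠ 0 := by exact_mod_cast Real.pi_ne_zero
  have e1 : (2 * Real.pi * I : ℂ)⁻¹ = -(I * (Real.pi : ℂ)⁻¹ / 2) := by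
    field_simp
    rw [I_sq]
    norm_num
  have e2 : (1 / (2 * (Real.pi ^ 2 / 6)) : ℂ) = 3 * (Real.pi : ℂ)⁻¹ ^ 2 := by
    field_simp
    norm_num
  have e3 : 3 * (Real.pi : ℂ)⁻¹ ^ 2 * (2 * Real.pi * I * γ 1 0 / denom γ z) =
      6 * I * (Real.pi : ℂ)⁻¹ * (γ 1 0 / denom γ z) := by
    field_simp
    ring
  simp only [Pi.sub_apply, Pi.smul_apply, smul_eq_mul, normalizedDeriv_D2, D2, riemannZeta_two,
    e1, e2, e3] at h1z
  simp only [Pi.add_apply, Pi.neg_apply, Pi.smul_apply, Pi.mul_apply, Pi.sub_apply, smul_eq_mul,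
    D2, riemannZeta_two, e2, e3]
  simp only [Int.cast_ofNat] at h1z
  -- With `x = c / (cz + d)`, the terms in `x E₂` and in `x²` cancel separately; `I_sq` handles the
  -- square of `6ix/π`.
  linear_combination -h1z + 3 * (Real.pi : ℂ)⁻¹ ^ 2 * (γ 1 0 / denom γ z) ^ 2 * I_sq

/-- Ramanujan's identity for the derivative of `E₂`. -/
lemma theta_E2 : thetaSeries e2Series =
    (12⁻¹ : ℂ) • (e2Series * e2Series - qExpansion 1 E₄) := by
  have h := (hasQExpansion_E2.normalizedDeriv.sub
    ((hasQExpansion_E2.mul hasQExpansion_E2).smul 12⁻¹)).add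
    ((hasQExpansion_modularForm E₄).smul 12⁻¹)
  have h0 := h.eq_zero_of_slash_eq (k := 4) (by norm_num) (fun γ ↦ by
    rw [SlashAction.add_slash, ModularForm.SL_smul_slash, slash_normalizedDeriv_E2_sub,
      slash_modularForm E₄ γ]) (by
    simp only [map_add, map_sub, PowerSeries.constantCoeff_smul, map_mul, constantCoeff_thetaSeries,
      constantCoeff_E _ (show Even 4 by decide), constantCoeff_e2Series]
    norm_num)
  rw [smul_sub]
  linear_combination h0

/-! ### Product and Rankin-Cohen identities -/

lemma E4_mul_E6 : qExpansion 1 E₄ * qExpansion 1 E₆ =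
    qExpansion 1 (E (by norm_num : 3 ≤ 10)) := by
  have h := ((hasQExpansion_modularForm E₄).mul (hasQExpansion_modularForm E₆)).sub
    (hasQExpansion_modularForm (E (by norm_num : 3 ≤ 10)))
  refine sub_eq_zero.mp (h.eq_zero_of_slash_eq (k := 10) (by norm_num) (fun γ ↦ ?_) ?_)
  · rw [sub_eq_add_neg, SlashAction.add_slash, SlashAction.neg_slash]
    congr 2
    · exact slash_modularForm (E₄.mul E₆) γ
    · exact slash_modularForm _ γ
  · simp only [map_sub, map_mul, constantCoeff_E _ (show Even 4 by decide),
      constantCoeff_E _ (show Even 6 by decide), constantCoeff_E _ (show Even 10 by decide)]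
    norm_num

lemma E4_cube_sub_E6_sq : qExpansion 1 E₄ ^ 3 - qExpansion 1 E₆ ^ 2 =
    (1728 : ℂ) • qExpansion 1 discriminant := by
  have h4 := hasQExpansion_modularForm E₄
  have h6 := hasQExpansion_modularForm E₆
  have h := (((h4.mul h4).mul h4).sub (h6.mul h6)).smul 1728⁻¹
  have hd : (1728⁻¹ : ℂ) • ((E₄ : ℍ → ℂ) * E₄ * E₄ - E₆ * E₆) = discriminant := by
    ext z
    simp only [discriminant_eq_E₄_cube_sub_E₆_sq z, Pi.smul_apply, Pi.sub_apply, Pi.mul_apply,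
      smul_eq_mul]
    ring
  rw [hd] at h
  rw [h.qExpansion_eq, smul_smul]
  norm_num
  ring

/-- The first Rankin-Cohen bracket of `E₄` and `E₆`. -/
lemma rankinCohen_one_E4_E6 :
    2 * (qExpansion 1 E₄ * thetaSeries (qExpansion 1 E₆)) -
      3 * (thetaSeries (qExpansion 1 E₄) * qExpansion 1 E₆) =
    -((1728 : ℂ) • qExpansion 1 discriminant) := by
  have h4 := natCast_mul_inv_smul (n := 3) (by norm_num)
    (e2Series * qExpansion 1 E₄ - qExpansion 1 E₆)
  have h6 := natCast_mul_inv_smul (n := 2) (by norm_num)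
    (e2Series * qExpansion 1 E₆ - qExpansion 1 E₄ * qExpansion 1 E₄)
  push_cast at h4 h6
  rw [← theta_E4] at h4
  rw [← theta_E6] at h6
  rw [← E4_cube_sub_E6_sq]
  -- The weights 2 and 3 make the `E₂E₄E₆` terms cancel.
  linear_combination qExpansion 1 E₄ * h6 - qExpansion 1 E₆ * h4

/-- The second Rankin-Cohen bracket of `E₄` and `E₆` vanishes. -/
lemma rankinCohen_two_E4_E6 :
    3 * (10 * (qExpansion 1 E₄ * thetaSeries (thetaSeries (qExpansion 1 E₆))) -
      35 * (thetaSeries (qExpansion 1 E₄) * thetaSeries (qExpansion 1 E₆)) +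
      21 * (thetaSeries (thetaSeries (qExpansion 1 E₄)) * qExpansion 1 E₆)) = 0 := by
  have h4 := natCast_mul_inv_smul (n := 3) (by norm_num)
    (e2Series * qExpansion 1 E₄ - qExpansion 1 E₆)
  have h6 := natCast_mul_inv_smul (n := 2) (by norm_num)
    (e2Series * qExpansion 1 E₆ - qExpansion 1 E₄ * qExpansion 1 E₄)
  have h2 := natCast_mul_inv_smul (n := 12) (by norm_num)
    (e2Series * e2Series - qExpansion 1 E₄)
  rw [Nat.cast_ofNat, Nat.cast_ofNat, ← theta_E4] at h4
  rw [Nat.cast_ofNat, Nat.cast_ofNat, ← theta_E6] at h6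
  rw [Nat.cast_ofNat, Nat.cast_ofNat, ← theta_E2] at h2
  -- The bracket has weight 14, beyond `eq_zero_of_slash_eq`, so second derivatives are eliminated
  -- by differentiating Ramanujan's formulas.
  have h4' := congrArg thetaSeries h4
  have h6' := congrArg thetaSeries h6
  rw [← Nat.cast_ofNat, thetaSeries_natCast_mul, Nat.cast_ofNat, thetaSeries_sub,
    thetaSeries_mul] at h4'
  rw [← Nat.cast_ofNat, thetaSeries_natCast_mul, Nat.cast_ofNat, thetaSeries_sub,
    thetaSeries_mul, thetaSeries_mul] at h6'
  linear_combination 15 * qExpansion 1 E₄ * h6' + 21 * qExpansion 1 E₆ * h4' +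
    3 * qExpansion 1 E₄ * qExpansion 1 E₆ * h2 -
    (15 * thetaSeries (qExpansion 1 E₆) + 3 * e2Series * qExpansion 1 E₆) * h4 -
    (30 * thetaSeries (qExpansion 1 E₄) + 3 * qExpansion 1 E₆) * h6

/-! ### Divisor sums and convolution relations -/

/-- The generating series of the divisor sums `σ k`. -/
noncomputable def sigmaSeries (k : ℕ) : PowerSeries ℂ :=
  PowerSeries.mk fun n ↦ (σ k n : ℂ)

lemma coeff_sigmaSeries (k n : ℕ) : (sigmaSeries k).coeff n = σ k n := by
  simp [sigmaSeries]

lemma qExpansion_E_eq {k : ℕ} (hk : 3 ≤ k) (hk2 : Even k) {c : ℂ}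
    (hc : -(2 * k / bernoulli k : ℂ) = c) :
    qExpansion 1 (E hk) = 1 + c • sigmaSeries (k - 1) := by
  ext n
  rw [E_qExpansion_coeff hk hk2, hc]
  rcases eq_or_ne n 0 with rfl | hn
  · simp [sigmaSeries]
  · simp [hn, sigmaSeries, PowerSeries.coeff_one]

lemma qExpansion_E4 : qExpansion 1 E₄ = 1 + (240 : ℂ) • sigmaSeries 3 :=
  qExpansion_E_eq _ (by decide) (by
    norm_num [show bernoulli 4 = -1 / 30 by decide +kernel])

lemma qExpansion_E6 : qExpansion 1 E₆ = 1 + (-504 : ℂ) • sigmaSeries 5 :=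
  qExpansion_E_eq _ (by decide) (by
    norm_num [show bernoulli 6 = 1 / 42 by decide +kernel])

lemma qExpansion_E10 :
    qExpansion 1 (E (by norm_num : 3 ≤ 10)) = 1 + (-264 : ℂ) • sigmaSeries 9 :=
  qExpansion_E_eq _ (by decide) (by
    norm_num [show bernoulli 10 = 5 / 66 by decide +kernel])

lemma thetaSeries_one_add_smul (c : ℂ) (p : PowerSeries ℂ) :
    thetaSeries (1 + c • p) = c • thetaSeries p := by
  simp [thetaSeries]

lemma thetaSeries_smul (c : ℂ) (p : PowerSeries ℂ) :
    thetaSeries (c • p) = c • thetaSeries p := by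
  simp [thetaSeries]

lemma coeff_mul_eq_sum_Ico {p r : PowerSeries ℂ} (hp : p.coeff 0 = 0) (hr : r.coeff 0 = 0)
    {n : ℕ} (hn : 1 ≤ n) :
    (p * r).coeff n = ∑ m ∈ Finset.Ico 1 n, p.coeff m * r.coeff (n - m) := by
  rw [PowerSeries.coeff_mul, Finset.Nat.sum_antidiagonal_eq_sum_range_succ_mk,
    Finset.sum_range_succ, Nat.sub_self, hr, mul_zero, add_zero, Finset.range_eq_Ico,
    Finset.sum_eq_sum_Ico_succ_bot (by omega), hp, zero_mul, zero_add]

/-- The convolution sum `∑ m ^ i (n - m) ^ j σ₃(m) σ₅(n - m)` over `1 ≤ m < n`. -/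
noncomputable def sigmaConv (n i j : ℕ) : ℂ :=
  ∑ m ∈ Finset.Ico 1 n, (m : ℂ) ^ i * ((n : ℂ) - m) ^ j * σ 3 m * σ 5 (n - m)

lemma coeff_mul_eq_sigmaConv {p r : PowerSeries ℂ} {i j : ℕ}
    (hp : ∀ m, p.coeff m = (m : ℂ) ^ i * σ 3 m) (hr : ∀ m, r.coeff m = (m : ℂ) ^ j * σ 5 m)
    {n : ℕ} (hn : 1 ≤ n) : (p * r).coeff n = sigmaConv n i j := by
  -- The end terms vanish even for exponent 0, since `σ k 0 = 0`.
  rw [coeff_mul_eq_sum_Ico (by simp [hp]) (by simp [hr]) hn]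
  refine Finset.sum_congr rfl fun m hm ↦ ?_
  rw [hp, hr, Nat.cast_sub (Finset.mem_Ico.mp hm).2.le]
  ring

lemma mul_sigmaConv (n i j : ℕ) :
    n * sigmaConv n i j = sigmaConv n (i + 1) j + sigmaConv n i (j + 1) := by
  rw [sigmaConv, sigmaConv, sigmaConv, Finset.mul_sum, ← Finset.sum_add_distrib]
  refine Finset.sum_congr rfl fun m _ ↦ ?_
  ring

lemma sigmaConv_zero_zero {n : ℕ} (hn : 1 ≤ n) :
    240 * (σ 3 n : ℂ) - 504 * σ 5 n - 120960 * sigmaConv n 0 0 = -264 * σ 9 n := by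
  have h := congrArg (PowerSeries.coeff n) E4_mul_E6
  rw [qExpansion_E4, qExpansion_E6, qExpansion_E10] at h
  simp only [add_mul, mul_add, one_mul, mul_one, smul_mul_assoc, mul_smul_comm, map_add,
    PowerSeries.coeff_smul, coeff_sigmaSeries, smul_eq_mul,
    coeff_mul_eq_sigmaConv (i := 0) (j := 0) (p := sigmaSeries 3) (r := sigmaSeries 5)
      (by simp [coeff_sigmaSeries]) (by simp [coeff_sigmaSeries]) hn] at h
  linear_combination h

lemma coeff_ofNat_mul (n k : ℕ) [k.AtLeastTwo] (p : PowerSeries ℂ) :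
    ((ofNat(k) : PowerSeries ℂ) * p).coeff n = (ofNat(k) : ℂ) * p.coeff n := by
  rw [← map_ofNat (PowerSeries.C (R := ℂ)) k, PowerSeries.coeff_C_mul]

lemma sigmaConv_first_order {n : ℕ} (hn : 1 ≤ n) :
    -1008 * (n * (σ 5 n : ℂ)) - 720 * (n * σ 3 n) - 241920 * sigmaConv n 0 1 +
      362880 * sigmaConv n 1 0 = -1728 * ramanujanTau n := by
  have h := congrArg (PowerSeries.coeff n) rankinCohen_one_E4_E6
  rw [qExpansion_E4, qExpansion_E6, thetaSeries_one_add_smul, thetaSeries_one_add_smul] at h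
  simp only [add_mul, mul_add, one_mul, mul_one, smul_mul_assoc, mul_smul_comm, map_add, map_sub,
    map_neg, coeff_ofNat_mul, PowerSeries.coeff_smul, coeff_sigmaSeries, smul_eq_mul,
    coeff_thetaSeries,
    coeff_mul_eq_sigmaConv (i := 0) (j := 1) (p := sigmaSeries 3)
      (r := thetaSeries (sigmaSeries 5))
      (by simp [coeff_sigmaSeries]) (by simp [coeff_sigmaSeries, coeff_thetaSeries]) hn,
    coeff_mul_eq_sigmaConv (i := 1) (j := 0) (p := thetaSeries (sigmaSeries 3))
      (r := sigmaSeries 5)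
      (by simp [coeff_sigmaSeries, coeff_thetaSeries]) (by simp [coeff_sigmaSeries]) hn] at h
  rw [ramanujanTau]
  linear_combination h

lemma sigmaConv_second_order {n : ℕ} (hn : 1 ≤ n) :
    -(n ^ 2 * (σ 5 n : ℂ)) + n ^ 2 * σ 3 n - 240 * sigmaConv n 0 2 + 840 * sigmaConv n 1 1 -
      504 * sigmaConv n 2 0 = 0 := by
  have h := congrArg (PowerSeries.coeff n) rankinCohen_two_E4_E6
  rw [qExpansion_E4, qExpansion_E6, thetaSeries_one_add_smul, thetaSeries_one_add_smul,
    thetaSeries_smul, thetaSeries_smul] at h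
  simp only [add_mul, mul_add, one_mul, mul_one, smul_mul_assoc, mul_smul_comm, map_add, map_sub,
    map_zero, coeff_ofNat_mul, PowerSeries.coeff_smul, coeff_sigmaSeries, smul_eq_mul,
    coeff_thetaSeries,
    coeff_mul_eq_sigmaConv (i := 0) (j := 2) (p := sigmaSeries 3)
      (r := thetaSeries (thetaSeries (sigmaSeries 5))) (by simp [coeff_sigmaSeries])
      (by intro m; simp only [coeff_sigmaSeries, coeff_thetaSeries]; ring) hn,
    coeff_mul_eq_sigmaConv (i := 1) (j := 1) (p := thetaSeries (sigmaSeries 3))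
      (r := thetaSeries (sigmaSeries 5)) (by simp [coeff_sigmaSeries, coeff_thetaSeries])
      (by simp [coeff_sigmaSeries, coeff_thetaSeries]) hn,
    coeff_mul_eq_sigmaConv (i := 2) (j := 0) (p := thetaSeries (thetaSeries (sigmaSeries 3)))
      (r := sigmaSeries 5)
      (by intro m; simp only [coeff_sigmaSeries, coeff_thetaSeries]; ring)
      (by simp [coeff_sigmaSeries]) hn] at h
  -- `15120 = 3 * 10 * 504 = 3 * 21 * 240`.
  linear_combination h / 15120

theorem theorem2p2 (n : ℕ) (hn : 1 ≤ n) :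
    (ramanujanTau n = -(11 / 24) * n * σ 9 n + 35 / 24 * n * σ 5 n
      + 350 * ∑ m ∈ Finset.Ico 1 n, ((n : ℂ) - m) * σ 3 m * σ 5 (n - m)) ∧
    (ramanujanTau n = 11 / 36 * n * σ 9 n + 25 / 36 * n * σ 3 n
      - 350 * ∑ m ∈ Finset.Ico 1 n, (m : ℂ) * σ 3 m * σ 5 (n - m)) ∧
    (ramanujanTau n = 1 / 6 * n * σ 9 n + 5 / 6 * n * σ 3 n
      - 420 / n * ∑ m ∈ Finset.Ico 1 n, (m : ℂ) ^ 2 * σ 3 m * σ 5 (n - m)) ∧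
    (ramanujanTau n = n * σ 9 n
      - 2100 / n * ∑ m ∈ Finset.Ico 1 n, (m : ℂ) * ((n : ℂ) - m) * σ 3 m * σ 5 (n - m)) ∧
    (ramanujanTau n = -(1 / 4) * n * σ 9 n + 5 / 4 * n * σ 5 n
      + 300 / n * ∑ m ∈ Finset.Ico 1 n, ((n : ℂ) - m) ^ 2 * σ 3 m * σ 5 (n - m)) := by
  have hn0 : (n : ℂ) ≠ 0 := Nat.cast_ne_zero.mpr (by omega)
  have e0 := sigmaConv_zero_zero hn
  have e1 := sigmaConv_first_order hn
  have e2 := sigmaConv_second_order hn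
  have h00 := mul_sigmaConv n 0 0
  have h10 := mul_sigmaConv n 1 0
  have h01 := mul_sigmaConv n 0 1
  have s01 : ∑ m ∈ Finset.Ico 1 n, ((n : ℂ) - m) * σ 3 m * σ 5 (n - m) = sigmaConv n 0 1 := by
    simp [sigmaConv]
  have s10 : ∑ m ∈ Finset.Ico 1 n, (m : ℂ) * σ 3 m * σ 5 (n - m) = sigmaConv n 1 0 := by
    simp [sigmaConv]
  have s20 : ∑ m ∈ Finset.Ico 1 n, (m : ℂ) ^ 2 * σ 3 m * σ 5 (n - m) = sigmaConv n 2 0 := by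
    simp [sigmaConv]
  have s11 : ∑ m ∈ Finset.Ico 1 n, (m : ℂ) * ((n : ℂ) - m) * σ 3 m * σ 5 (n - m) =
      sigmaConv n 1 1 := by
    simp [sigmaConv]
  have s02 : ∑ m ∈ Finset.Ico 1 n, ((n : ℂ) - m) ^ 2 * σ 3 m * σ 5 (n - m) =
      sigmaConv n 0 2 := by
    simp [sigmaConv]
  have hdiv (c x : ℂ) : n * (c / n * x) = c * x := by
    field_simp
  norm_num at h00 h10 h01
  rw [s01, s10, s20, s11, s02]
  refine ⟨?_, ?_, ?_, ?_, ?_⟩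
  -- `h00` trades `S 1 0` for `S 0 0`; the multiple of `e0` then removes both `S 0 0` and `σ₃`.
  · linear_combination e1 / 1728 + n * e0 / 576 + 210 * h00
  · linear_combination e1 / 1728 - n * e0 / 864 - 140 * h00
  · apply mul_left_cancel₀ hn0
    -- `n * h00 + h10 + h01` says `n² S 0 0 = S 2 0 + 2 S 1 1 + S 0 2`; `140 * h01 - 210 * h10`
    -- turns the sums in `n * e1` into second-order ones. The multiples of `e0` and `e2` remove the
    -- unwanted sums and `σ₅`.
    linear_combination n * e1 / 1728 - 35 / 132 * e2 - n ^ 2 * e0 / 1584 - 840 / 11 * (n * h00 + h10 + h01) +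
      140 * h01 - 210 * h10 + hdiv 420 (sigmaConv n 2 0)
  · apply mul_left_cancel₀ hn0
    linear_combination n * e1 / 1728 + 175 / 132 * e2 - n ^ 2 * e0 / 264 - 5040 / 11 * (n * h00 + h10 + h01) +
      140 * h01 - 210 * h10 + hdiv 2100 (sigmaConv n 1 1)
  · apply mul_left_cancel₀ hn0
    linear_combination n * e1 / 1728 + 25 / 132 * e2 + n ^ 2 * e0 / 1056 + 1260 / 11 * (n * h00 + h10 + h01) +
      140 * h01 - 210 * h10 - hdiv 300 (sigmaConv n 0 2)
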